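/- Let $n \ge 0$ be an integer, and let $S_n$ be the symmetric group of $[n] = \{1,\dots,n\}$, with product $(uv)(i)=u(v(i))$. Let $w_0 \in S_n$ be the permutation $i \mapsto n+1-i$. For a composition $\alpha = (\alpha_1,\dots,\alpha_k)$ of $n$ (a tuple of positive integers with sum $n$) set $$B_\alpha = \sum_{\substack{w \in S_n \\ \operatorname{Des} w \subseteq I(\alpha)}} w,$$ where $\operatorname{Des} w = \{ i \in \{1,\dots,n-1\} : w(i) > w(i+1)\}$ and $I(\alpha) = \{\alpha_1 + \dots + \alpha_i : 1 \le i \le k-1\}$. A face is a tuple $F = (F_1,\dots,F_p)$ of nonempty pairwise disjoint sets with union $[n]$; its length is $\ell(F) = p$ and its type is the composition $(|F_1|,\dots,|F_p|)$. For a composition $\alpha$ of $n$ and a face $F$, let $n_\alpha(F)$ be the number of faces $G$ of type $\alpha$ such that each block of $F$ is a subset of some block of $G$, and let $\widetilde n_\alpha(F) = (-1)^{n-\ell(F)} n_\alpha(F)$. Let $\mathbf{k}$ be a (totally) ordered commutative ring, and let $\gamma = (\gamma_\alpha)$ be a family of nonnegative elements $\gamma_\alpha \ge 0$ of $\mathbf{k}$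 indexed by all compositions $\alpha$ of $n$. Set $$B_\gamma = \sum_{\alpha} \gamma_\alpha B_\alpha \in \mathbf{k}[S_n], \qquad \widetilde n_\gamma(F) = \sum_{\alpha} \gamma_\alpha \widetilde n_\alpha(F) \in \mathbf{k} \quad \text{for each face } F,$$ and let $\widetilde n_\gamma(\mathcal F) = \{ \widetilde n_\gamma(F) : F \text{ a face}\}$. Then, in the group algebra $\mathbf{k}[S_n]$, $$\prod_{\kappa \in \widetilde n_\gamma(\mathcal F)} (w_0 B_\gamma - \kappa) = 0 \qquad\text{and}\qquad \prod_{\kappa \in \widetilde n_\gamma(\mathcal F)} (B_\gamma w_0 - \kappa) = 0,$$ where each product has exactly one factor for each distinct element $\kappa$ of the finite set $\widetilde n_\gamma(\mathcal F)$. -/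

import Mathlib

/-! ### The symmetric group algebra and the elements `B_α` -/

/-- The longest word `w₀`: the permutation `i ↦ n + 1 - i` of `{1, …, n}`, which on the
zero-based index type `Fin n` is `i ↦ n - 1 - i`. -/
def longestWord (n : ℕ) : Equiv.Perm (Fin n) := Fin.revPerm

/-- The descent set of `w`: all `i ∈ {1, …, n - 1}` with `w(i) > w(i + 1)`. The `i`-th element of
`{1, …, n}` is the element of `Fin n` with value `i - 1`. -/
def descentSet {n : ℕ} (w : Equiv.Perm (Fin n)) : Finset ℕ :=
  (Finset.Icc 1 (n - 1)).filter
    fun i => ∃ a b : Fin n, (a : ℕ) + 1 = i ∧ (b : ℕ) + 1 = i + 1 ∧ w a > w b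

/-- The subset `{α₁, α₁ + α₂, …, α₁ + ⋯ + α_{k-1}}` of `{1, …, n - 1}` that corresponds to a
composition `α = (α₁, …, α_k)` of `n`: the only one whose gaps are the entries of `α`. -/
def partialSumSet {n : ℕ} (α : Composition n) : Finset ℕ :=
  (Finset.Ico 1 α.length).image α.sizeUpTo

/-- `B_I = ∑ w`, over all permutations `w` with `Des w ⊆ I`. -/
noncomputable def elemBSet (k : Type*) [CommRing k] (n : ℕ) (I : Finset ℕ) :
    MonoidAlgebra k (Equiv.Perm (Fin n)) :=
  ∑ w ∈ (Finset.univ : Finset (Equiv.Perm (Fin n))).filter (fun w => descentSet w ⊆ I),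
    MonoidAlgebra.of k (Equiv.Perm (Fin n)) w

/-- `B_α` for a composition `α` of `n`. -/
noncomputable def elemB (k : Type*) [CommRing k] {n : ℕ} (α : Composition n) :
    MonoidAlgebra k (Equiv.Perm (Fin n)) :=
  elemBSet k n (partialSumSet α)

/-- `B_γ = ∑_α γ_α B_α`, over all compositions `α` of `n`. -/
noncomputable def weightedB {k : Type*} [CommRing k] {n : ℕ} (γ : Composition n → k) :
    MonoidAlgebra k (Equiv.Perm (Fin n)) :=
  ∑ α : Composition n, γ α • elemB k α

/-! ### Faces -/

/-- A face, or set composition, of the `n`-element set: an ordered tuple of nonempty, pairwise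
disjoint sets that cover the set. -/
@[ext]
structure Face (n : ℕ) where
  blocks : List (Finset (Fin n))
  nonempty_of_mem : ∀ A ∈ blocks, A.Nonempty
  disjoint : blocks.Pairwise Disjoint
  cover : ∀ x : Fin n, ∃ A ∈ blocks, x ∈ A

namespace Face

variable {n : ℕ}

instance : DecidableEq (Face n) := fun F G =>
  decidable_of_iff (F.blocks = G.blocks) Face.ext_iff.symm

theorem nodup (F : Face n) : F.blocks.Nodup := by
  refine List.Pairwise.imp_of_mem ?_ F.disjoint
  rintro A B hA - h rfl
  exact (F.nonempty_of_mem A hA).ne_empty (disjoint_self.mp h)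

/-- There are finitely many faces. -/
instance : Fintype (Face n) :=
  Fintype.ofEquiv
    {l : {l : List (Finset (Fin n)) // l.Nodup} //
      (∀ A ∈ l.1, A.Nonempty) ∧ l.1.Pairwise Disjoint ∧ ∀ x : Fin n, ∃ A ∈ l.1, x ∈ A}
    { toFun := fun l => ⟨l.1.1, l.2.1, l.2.2.1, l.2.2.2⟩
      invFun := fun F => ⟨⟨F.blocks, F.nodup⟩, F.nonempty_of_mem, F.disjoint, F.cover⟩
      left_inv := fun _ => rfl
      right_inv := fun _ => rfl }

theorem sum_map_card (F : Face n) : (F.blocks.map Finset.card).sum = n := by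
  have h1 : (F.blocks.map Finset.card).sum = ∑ A ∈ F.blocks.toFinset, A.card :=
    (List.sum_toFinset _ F.nodup).symm
  have h2 : F.blocks.toFinset.biUnion id = Finset.univ := by
    ext x
    simpa using F.cover x
  have h3 : ∀ A ∈ F.blocks.toFinset, ∀ B ∈ F.blocks.toFinset, A ≠ B →
      Disjoint (id A) (id B) := by
    intro A hA B hB hAB
    exact F.disjoint.forall (List.mem_toFinset.mp hA) (List.mem_toFinset.mp hB) hAB
  have h4 := Finset.card_biUnion h3
  rw [h2, Finset.card_univ, Fintype.card_fin] at h4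
  rw [h1]
  exact h4.symm

/-- The type of a face: the composition formed by the sizes of its blocks. -/
def type (F : Face n) : Composition n where
  blocks := F.blocks.map Finset.card
  blocks_pos := by
    intro i hi
    obtain ⟨A, hA, rfl⟩ := List.mem_map.mp hi
    exact (F.nonempty_of_mem A hA).card_pos
  blocks_sum := F.sum_map_card

/-- The length of a face: its number of blocks. -/
def length (F : Face n) : ℕ := F.blocks.length

/-- In particular, the subtraction `n - F.length` below is never truncated. -/
theorem length_le (F : Face n) : F.length ≤ n := by
  have h := F.type.length_le
  simpa [type, length, Composition.length] using h

/-- `F` is contained in `G` if every block of `F` is a subset of a block of `G`. -/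
def IsContained (F G : Face n) : Prop :=
  ∀ A ∈ F.blocks, ∃ B ∈ G.blocks, A ⊆ B

instance (F G : Face n) : Decidable (F.IsContained G) :=
  inferInstanceAs (Decidable (∀ A ∈ F.blocks, ∃ B ∈ G.blocks, A ⊆ B))

end Face

/-! ### Knapsack numbers -/

/-- The knapsack number `n_α(F)`: the number of faces `G` of type `α` that contain `F`. -/
def knapsack {n : ℕ} (α : Composition n) (F : Face n) : ℕ :=
  ((Finset.univ : Finset (Face n)).filter fun G => F.IsContained G ∧ G.type = α).card

/-- The signed knapsack number `(-1)^(n - ℓ(F)) n_α(F)`. -/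
def signedKnapsack {n : ℕ} (α : Composition n) (F : Face n) : ℤ :=
  (-1) ^ (n - F.length) * (knapsack α F : ℤ)

/-- The weighted signed knapsack number `∑_α γ_α ñ_α(F)`, over all compositions `α` of `n`. -/
def weightedSignedKnapsack {k : Type*} [CommRing k] {n : ℕ} (γ : Composition n → k)
    (F : Face n) : k :=
  ∑ α : Composition n, γ α * ((signedKnapsack α F : ℤ) : k)

/-- The polynomial `∏ (x - κ)`, where `κ` ranges over the set of weighted signed knapsack numbers
of all faces (each value is taken once). -/
noncomputable def knapsackPolynomial {k : Type*} [CommRing k] [DecidableEq k] {n : ℕ}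
    (γ : Composition n → k) : Polynomial k :=
  ∏ κ ∈ (Finset.univ : Finset (Face n)).image (weightedSignedKnapsack γ),
    (Polynomial.X - Polynomial.C κ)

/-! Both identities are proved for operators on `k[S_n]`. A face `F` acts on a permutation `w` by
sorting the word of `w` stably by the blocks of `F`; this turns the product of faces into
composition (`act_prod`, `op_mul_op`). Right multiplication by `B_γ` is then `∑ γ (type G) • op G`
(`mulRight_weightedB`), and right multiplication by `w₀` after `op F` expands as an alternating sum
of `op H` over the refinements `H` of `F` (`op_mul_mulRight_longestWord`).

Filter the span of the `op F` by the unsigned number `weight γ F`, which can only grow as `F` is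
refined. Modulo larger weights, right multiplication by `B_γ` is the scalar `μ` on the layer of
weight `μ`, because `F G = F` if `G` contains `F`, and otherwise `F G` has larger weight or
coefficient zero. So on this layer either product `t` of the two multiplications is `μ` times right
multiplication by `w₀`.

If all faces of weight `μ` have the same sign `ε`, a proper refinement has strictly larger weight,
so `w₀` acts as `ε` and `t - ε μ` kills the layer. If both signs occur, both `μ` and `-μ` are signed
knapsack numbers, and `t² - μ²` kills the layer because `w₀² = 1`. Multiplying over all layers
annihilates the operator of the one-block face, which is the identity. -/

namespace Face

variable {n : ℕ}

/-! ### The block index of an element, and the face of a function -/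

/-- The index of the block of `F` that contains `x`. -/
def key (F : Face n) (x : Fin n) : ℕ :=
  F.blocks.findIdx fun A => x ∈ A

theorem key_lt (F : Face n) (x : Fin n) : F.key x < F.blocks.length := by
  obtain ⟨A, hA, hx⟩ := F.cover x
  exact List.findIdx_lt_length_of_exists ⟨A, hA, by simpa using hx⟩

theorem mem_getElem_key (F : Face n) (x : Fin n) : x ∈ F.blocks[F.key x]'(F.key_lt x) := by
  exact of_decide_eq_true (List.findIdx_getElem (w := F.key_lt x))

theorem mem_getElem_iff (F : Face n) {x : Fin n} {i : ℕ} (hi : i < F.blocks.length) :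
    x ∈ F.blocks[i] ↔ F.key x = i := by
  constructor
  · intro hx
    by_contra hne
    have hd : Disjoint (F.blocks[F.key x]'(F.key_lt x)) F.blocks[i] := by
      rcases lt_or_gt_of_ne hne with h | h
      · exact List.pairwise_iff_getElem.mp F.disjoint _ _ _ _ h
      · exact (List.pairwise_iff_getElem.mp F.disjoint _ _ _ _ h).symm
    exact Finset.disjoint_left.mp hd (F.mem_getElem_key x) hx
  · rintro rfl
    exact F.mem_getElem_key x

theorem getElem_eq_filter (F : Face n) {i : ℕ} (hi : i < F.blocks.length) :
    F.blocks[i] = Finset.univ.filter fun x => F.key x = i := by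
  ext x
  simp [F.mem_getElem_iff hi]

theorem exists_key_eq (F : Face n) {i : ℕ} (hi : i < F.blocks.length) : ∃ x, F.key x = i := by
  obtain ⟨x, hx⟩ := F.nonempty_of_mem _ (List.getElem_mem hi)
  exact ⟨x, (F.mem_getElem_iff hi).mp hx⟩

theorem image_key (F : Face n) : Finset.univ.image F.key = Finset.range F.length := by
  ext i
  simp only [Finset.mem_image, Finset.mem_univ, true_and, Finset.mem_range]
  exact ⟨fun ⟨x, hx⟩ => hx ▸ F.key_lt x, fun h => F.exists_key_eq h⟩

theorem length_eq_card_image_key (F : Face n) : F.length = (Finset.univ.image F.key).card := by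
  rw [image_key, Finset.card_range]

theorem ext_of_key {F G : Face n} (h : F.key = G.key) : F = G := by
  have hl : F.blocks.length = G.blocks.length := by
    have := F.length_eq_card_image_key
    rwa [h, ← G.length_eq_card_image_key] at this
  refine Face.ext (List.ext_getElem hl fun i h1 h2 => ?_)
  rw [getElem_eq_filter, getElem_eq_filter, h]

/-- A value `m > 0` of `f` has a predecessor `m - 1` attained at some `y`, and `g` must also be
smaller at `y`. Applied in both directions, this shows that a function onto an initial segment of
`ℕ` is determined by the preorder it induces. -/
theorem le_of_le_iff_le {f g : Fin n → ℕ} (hf : ∀ x, ∀ i < f x, ∃ y, f y = i)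
    (h : ∀ x y, f x ≤ f y ↔ g x ≤ g y) (x : Fin n) : f x ≤ g x := by
  induction hm : f x using Nat.strong_induction_on generalizing x with
  | _ m ih =>
    rcases Nat.eq_zero_or_pos m with rfl | hpos
    · exact Nat.zero_le _
    · obtain ⟨y, hy⟩ := hf x (m - 1) (by omega)
      have h1 := ih (m - 1) (by omega) y hy
      have h2 := (not_congr (h x y)).mp (by omega)
      omega

theorem exists_key_eq_of_lt (F : Face n) (x : Fin n) : ∀ i < F.key x, ∃ y, F.key y = i :=
  fun _ hi => F.exists_key_eq (hi.trans (F.key_lt x))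

/-- A face amounts to a total preorder on `Fin n`; equalities of faces are mostly checked in this
form. -/
theorem ext_of_le_iff {F G : Face n}
    (h : ∀ x y, F.key x ≤ F.key y ↔ G.key x ≤ G.key y) : F = G :=
  ext_of_key <| funext fun x => le_antisymm (le_of_le_iff_le F.exists_key_eq_of_lt h x)
    (le_of_le_iff_le G.exists_key_eq_of_lt (fun x y => (h x y).symm) x)

/-- The face whose blocks are the fibers of `f`, in the order of the values of `f`. -/
def ofFun {α : Type*} [LinearOrder α] (f : Fin n → α) : Face n where
  blocks := ((Finset.univ.image f).sort (· ≤ ·)).map fun a => Finset.univ.filter fun x => f x = a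
  nonempty_of_mem := by
    intro A hA
    obtain ⟨a, ha, rfl⟩ := List.mem_map.mp hA
    obtain ⟨x, -, hx⟩ := Finset.mem_image.mp ((Finset.mem_sort _).mp ha)
    exact ⟨x, by simpa using hx⟩
  disjoint := by
    rw [List.pairwise_map]
    refine List.Pairwise.imp ?_ (Finset.sort_nodup (Finset.univ.image f) (· ≤ ·))
    intro a b hab
    rw [Finset.disjoint_left]
    intro x hx hx'
    simp only [Finset.mem_filter, Finset.mem_univ, true_and] at hx hx'
    exact hab (hx.symm.trans hx')
  cover x := ⟨_, List.mem_map.mpr ⟨f x, by simp, rfl⟩, by simp⟩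

/-! ### Faces as the total preorders induced by functions -/

section OfFun

variable {α : Type*} [LinearOrder α]

theorem length_ofFun (f : Fin n → α) : (ofFun f).length = (Finset.univ.image f).card := by
  simp [ofFun, length]

theorem ofFun_key_lt_of_lt (f : Fin n → α) {x y : Fin n} (h : f x < f y) :
    (ofFun f).key x < (ofFun f).key y := by
  set l := (Finset.univ.image f).sort (· ≤ ·) with hl
  have hval : ∀ z, ∃ hz : (ofFun f).key z < l.length, l[(ofFun f).key z] = f z := by
    intro z
    have h1 := (ofFun f).key_lt z
    have h2 := (ofFun f).mem_getElem_key z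
    refine ⟨h1.trans_eq (List.length_map _), ?_⟩
    simp only [ofFun, List.getElem_map, Finset.mem_filter, Finset.mem_univ, true_and] at h2
    exact h2.symm
  obtain ⟨hx, ex⟩ := hval x
  obtain ⟨hy, ey⟩ := hval y
  by_contra hle
  have hs : l.Pairwise (· ≤ ·) := Finset.pairwise_sort _ _
  have := List.SortedLE.getElem_le_getElem_of_le hs.sortedLE (hi := hy) (hj := hx) (not_lt.mp hle)
  rw [ex, ey] at this
  exact absurd h (not_lt.mpr this)

theorem ofFun_key_eq_of_eq (f : Fin n → α) {x y : Fin n} (h : f x = f y) :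
    (ofFun f).key x = (ofFun f).key y := by
  have h1 := (ofFun f).key_lt y
  rw [← (ofFun f).mem_getElem_iff h1]
  have h2 := (ofFun f).mem_getElem_key y
  simp only [ofFun, List.getElem_map, Finset.mem_filter, Finset.mem_univ, true_and] at h2 ⊢
  rw [h, h2]

theorem ofFun_key_lt_iff (f : Fin n → α) {x y : Fin n} :
    (ofFun f).key x < (ofFun f).key y ↔ f x < f y := by
  refine ⟨fun h => ?_, ofFun_key_lt_of_lt f⟩
  rcases lt_trichotomy (f x) (f y) with h1 | h1 | h1
  · exact h1
  · exact absurd (ofFun_key_eq_of_eq f h1) h.ne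
  · exact absurd (ofFun_key_lt_of_lt f h1) h.not_gt

theorem ofFun_key_le_iff (f : Fin n → α) {x y : Fin n} :
    (ofFun f).key x ≤ (ofFun f).key y ↔ f x ≤ f y := by
  rw [← not_lt, ← not_lt, ofFun_key_lt_iff]

theorem ofFun_key_eq_iff (f : Fin n → α) {x y : Fin n} :
    (ofFun f).key x = (ofFun f).key y ↔ f x = f y := by
  simp only [le_antisymm_iff, ofFun_key_le_iff]

theorem ofFun_eq_iff (f : Fin n → α) {F : Face n} :
    ofFun f = F ↔ ∀ x y, f x ≤ f y ↔ F.key x ≤ F.key y := by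
  constructor
  · rintro rfl x y
    exact (ofFun_key_le_iff f).symm
  · intro h
    exact ext_of_le_iff fun x y => (ofFun_key_le_iff f).trans (h x y)

theorem key_ofFun {f : Fin n → ℕ} (hf : ∀ x, ∀ i < f x, ∃ y, f y = i) : (ofFun f).key = f :=
  funext fun x => le_antisymm
    (le_of_le_iff_le (ofFun f).exists_key_eq_of_lt (fun _ _ => ofFun_key_le_iff f) x)
    (le_of_le_iff_le hf (fun _ _ => (ofFun_key_le_iff f).symm) x)

end OfFun

/-! ### Containment and order refinement -/

theorem isContained_iff {F G : Face n} :
    F.IsContained G ↔ ∀ x y, F.key x = F.key y → G.key x = G.key y := by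
  constructor
  · intro h x y hxy
    obtain ⟨B, hB, hAB⟩ := h _ (List.getElem_mem (F.key_lt x))
    obtain ⟨i, hi, rfl⟩ := List.getElem_of_mem hB
    have h1 := hAB (F.mem_getElem_key x)
    have h2 := hAB ((F.mem_getElem_iff (F.key_lt x)).mpr hxy.symm)
    rw [G.mem_getElem_iff hi] at h1 h2
    rw [h1, h2]
  · intro h A hA
    obtain ⟨i, hi, rfl⟩ := List.getElem_of_mem hA
    obtain ⟨x, hx⟩ := F.nonempty_of_mem _ hA
    refine ⟨_, List.getElem_mem (G.key_lt x), fun y hy => ?_⟩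
    rw [G.mem_getElem_iff]
    rw [F.mem_getElem_iff] at hx hy
    exact h _ _ (hy.trans hx.symm)

theorem IsContained.trans {F G H : Face n} (h1 : F.IsContained G) (h2 : G.IsContained H) :
    F.IsContained H := by
  rw [isContained_iff] at *
  exact fun x y h => h2 x y (h1 x y h)

/-- `H` refines `F` as an ordered set partition: `H` arises from `F` by cutting every block into
consecutive pieces. -/
def Refines (H F : Face n) : Prop := ∀ x y, H.key x ≤ H.key y → F.key x ≤ F.key y

instance (H F : Face n) : Decidable (H.Refines F) :=
  inferInstanceAs (Decidable (∀ x y, H.key x ≤ H.key y → F.key x ≤ F.key y))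

theorem Refines.isContained {F H : Face n} (h : H.Refines F) : H.IsContained F :=
  isContained_iff.mpr fun x y e => le_antisymm (h x y e.le) (h y x e.ge)

theorem Refines.refl (F : Face n) : F.Refines F := fun _ _ h => h

/-- A proper refinement of `F` refines a face that has exactly one block more than `F`. -/
theorem Refines.exists_length_eq_succ {F H : Face n} (h : H.Refines F) (hne : H ≠ F) :
    ∃ G : Face n, H.IsContained G ∧ G.IsContained F ∧ G.length = F.length + 1 := by
  obtain ⟨x, y, hF, hH⟩ : ∃ x y, F.key y ≤ F.key x ∧ H.key x < H.key y := by
    by_contra! hcon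
    refine hne (ext_of_le_iff fun x y => ⟨h x y, fun hxy => ?_⟩)
    exact hcon y x hxy
  have hxy : F.key x = F.key y := le_antisymm (h x y hH.le) hF
  -- Doubling leaves room for one new value, `2 * F.key x + 1`. It splits off the part of the
  -- `F`-block of `x` that comes after `x` in `H`, without cutting any block of `H`.
  let g : Fin n → ℕ := fun z =>
    2 * F.key z + if F.key z = F.key x ∧ H.key x < H.key z then 1 else 0
  have gF : ∀ u v, g u = g v → F.key u = F.key v := by
    intro u v huv
    simp only [g] at huv
    split_ifs at huv <;> omega
  refine ⟨ofFun g, ?_, ?_, ?_⟩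
  · rw [isContained_iff]
    intro u v huv
    rw [ofFun_key_eq_iff]
    simp only [g, isContained_iff.mp h.isContained u v huv, huv]
  · rw [isContained_iff]
    intro u v huv
    exact gF u v ((ofFun_key_eq_iff g).mp huv)
  · have himg : Finset.univ.image g =
        insert (2 * F.key x + 1) ((Finset.univ.image F.key).image (2 * ·)) := by
      ext i
      simp only [Finset.mem_image, Finset.mem_insert, Finset.mem_univ, true_and,
        exists_exists_eq_and]
      constructor
      · rintro ⟨z, rfl⟩
        by_cases hz : F.key z = F.key x ∧ H.key x < H.key z
        · left; simp only [g, hz, and_self, if_true]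
        · right; exact ⟨z, by simp only [g, hz, if_false, add_zero]⟩
      · rintro (rfl | ⟨z, rfl⟩)
        · exact ⟨y, by simp [g, hxy, hH]⟩
        · by_cases hz : F.key z = F.key x
          · exact ⟨x, by simp [g, hz]⟩
          · exact ⟨z, by simp [g, hz]⟩
    rw [length_ofFun, himg, Finset.card_insert_of_notMem, Finset.card_image_of_injective,
      length_eq_card_image_key]
    · exact fun a b hab => by simpa using hab
    · simp only [Finset.mem_image, not_exists, not_and]
      intro a _
      omega

/-! ### Products and relabellings of faces -/

/-- The product of two faces: the blocks of `F`, each cut by the blocks of `G`. -/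
def prod (F G : Face n) : Face n := ofFun fun x => toLex (F.key x, G.key x)

theorem prod_isContained_left (F G : Face n) : (F.prod G).IsContained F := by
  rw [isContained_iff]
  intro x y h
  simpa [prod, ofFun_key_eq_iff] using congrArg Prod.fst (congrArg ofLex ((ofFun_key_eq_iff _).mp h))

theorem prod_isContained_right (F G : Face n) : (F.prod G).IsContained G := by
  rw [isContained_iff]
  intro x y h
  simpa [prod, ofFun_key_eq_iff] using congrArg Prod.snd (congrArg ofLex ((ofFun_key_eq_iff _).mp h))

theorem prod_eq_left {F G : Face n} (h : F.IsContained G) : F.prod G = F := by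
  rw [prod, ofFun_eq_iff]
  intro x y
  rw [Prod.Lex.toLex_le_toLex]
  constructor
  · rintro (h1 | h1)
    · exact h1.le
    · exact h1.1.le
  · intro h1
    rcases h1.lt_or_eq with h2 | h2
    · exact Or.inl h2
    · exact Or.inr ⟨h2, (isContained_iff.mp h x y h2).le⟩

/-- The face with the block index `F.key ∘ w`. -/
def perm (w : Equiv.Perm (Fin n)) (F : Face n) : Face n := ofFun (F.key ∘ w)

theorem key_perm (w : Equiv.Perm (Fin n)) (F : Face n) : (F.perm w).key = F.key ∘ w := by
  refine key_ofFun fun x i hi => ?_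
  obtain ⟨y, hy⟩ := F.exists_key_eq_of_lt (w x) i hi
  exact ⟨w⁻¹ y, by simpa using hy⟩

theorem perm_perm (v w : Equiv.Perm (Fin n)) (F : Face n) : (F.perm v).perm w = F.perm (v * w) := by
  apply ext_of_key
  simp only [key_perm]
  rfl

theorem perm_one (F : Face n) : F.perm 1 = F := ext_of_key <| by rw [key_perm]; rfl

theorem length_perm (w : Equiv.Perm (Fin n)) (F : Face n) : (F.perm w).length = F.length := by
  rw [length_eq_card_image_key, length_eq_card_image_key, key_perm, ← Finset.image_image,
    Finset.image_univ_equiv]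

/-- Relabelling by `w`, as a permutation of the set of faces. -/
def permEquiv (w : Equiv.Perm (Fin n)) : Face n ≃ Face n where
  toFun := perm w
  invFun := perm w⁻¹
  left_inv F := by rw [perm_perm, mul_inv_cancel, perm_one]
  right_inv F := by rw [perm_perm, inv_mul_cancel, perm_one]

theorem perm_refines_iff {w : Equiv.Perm (Fin n)} {F H : Face n} :
    (H.perm w).Refines (F.perm w) ↔ H.Refines F := by
  simp only [Refines, key_perm, Function.comp_apply]
  refine ⟨fun h x y => ?_, fun h x y => h _ _⟩
  simpa using h (w⁻¹ x) (w⁻¹ y)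

end Face

/-! ### Block indices of compositions -/

namespace Composition

variable {n : ℕ}

theorem monotone_index (α : Composition n) : Monotone fun i => (α.index i : ℕ) := by
  intro i j hij
  by_contra! h
  have h1 := α.lt_sizeUpTo_index_succ j
  have h2 := α.monotone_sizeUpTo (Nat.succ_le_of_lt h)
  have h3 := α.sizeUpTo_index_le i
  have h4 : (i : ℕ) ≤ j := hij
  simp only [Fin.val_succ, Nat.succ_eq_add_one] at h1 h2
  omega

theorem card_filter_index_eq (α : Composition n) {i : ℕ} (hi : i < α.length) :
    (Finset.univ.filter fun x => (α.index x : ℕ) = i).card = α.blocks[i] := by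
  have : (Finset.univ.filter fun x => (α.index x : ℕ) = i) =
      Finset.univ.map (α.embedding ⟨i, hi⟩).toEmbedding := by
    ext x
    have := α.mem_range_embedding_iff' (j := x) (i := ⟨i, hi⟩)
    rw [Set.mem_range, Fin.ext_iff] at this
    simp only [Finset.mem_filter, Finset.mem_univ, true_and, Finset.mem_map,
      RelEmbedding.coe_toEmbedding]
    exact eq_comm.trans this.symm
  rw [this, Finset.card_map, Finset.card_univ, Fintype.card_fin]
  rfl

theorem exists_index_eq (α : Composition n) {i : ℕ} (hi : i < α.length) :
    ∃ x, (α.index x : ℕ) = i := by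
  have h : 0 < α.blocks[i] := α.blocks_pos (List.getElem_mem hi)
  rw [← α.card_filter_index_eq hi, Finset.card_pos] at h
  obtain ⟨x, hx⟩ := h
  exact ⟨x, by simpa using hx⟩

/-- The zero-based value of `b` is the one-based position of `a`, so this says that `α` cuts between
the neighbours `a` and `b`. -/
theorem succ_mem_partialSumSet_iff (α : Composition n) {a b : Fin n} (hab : (b : ℕ) = a + 1) :
    (b : ℕ) ∈ partialSumSet α ↔ (α.index a : ℕ) < α.index b := by
  have ha := α.sizeUpTo_index_le a
  have ha' := α.lt_sizeUpTo_index_succ a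
  have hb := α.sizeUpTo_index_le b
  have hb' := α.lt_sizeUpTo_index_succ b
  simp only [Fin.val_succ] at ha' hb'
  simp only [partialSumSet, Finset.mem_image, Finset.mem_Ico]
  constructor
  · rintro ⟨t, -, ht⟩
    have h1 : (α.index a : ℕ) < t := by
      by_contra! h
      have := α.monotone_sizeUpTo h
      omega
    have h2 : t < (α.index b : ℕ) + 1 := by
      by_contra! h
      have := α.monotone_sizeUpTo h
      omega
    omega
  · intro h
    refine ⟨α.index b, ⟨by omega, (α.index b).2⟩, ?_⟩
    have := α.monotone_sizeUpTo (Nat.succ_le_of_lt h)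
    simp only [Nat.succ_eq_add_one] at this
    omega

end Composition

/-! ### Descents and segments of a composition -/

section

variable {n : ℕ}

/-- A transitive relation that holds for neighbours on which the monotone function `g` agrees
holds for any two elements on which `g` agrees. -/
theorem Monotone.rel_of_eq {g : Fin n → ℕ} (hg : Monotone g) {r : Fin n → Fin n → Prop}
    (htrans : ∀ a b c, r a b → r b c → r a c)
    (h : ∀ a b : Fin n, (b : ℕ) = a + 1 → g a = g b → r a b)
    {i j : Fin n} (hij : i < j) (he : g i = g j) : r i j := by
  obtain ⟨j, hj⟩ := j
  induction j with
  | zero => exact absurd hij (Nat.not_lt_zero _)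
  | succ j ih =>
    have hij' : (i : ℕ) < j + 1 := hij
    rcases Nat.lt_succ_iff_lt_or_eq.mp hij' with h1 | h1
    · have h2 : i < ⟨j, by omega⟩ := h1
      have h3 : g ⟨j, by omega⟩ ≤ g ⟨j + 1, hj⟩ := hg (Nat.le_succ j)
      have h4 := hg h2.le
      have h5 : g i = g ⟨j, by omega⟩ := by omega
      exact htrans _ _ _ (ih _ h2 h5) (h _ _ rfl (h5.symm.trans he))
    · exact h _ _ (by simp [h1]) he

/-- No descent inside a segment of `α` means that `w` increases between neighbours of the segment,
hence on the whole segment by transitivity. -/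
theorem descentSet_subset_iff (w : Equiv.Perm (Fin n)) (α : Composition n) :
    descentSet w ⊆ partialSumSet α ↔
      ∀ i j, i < j → (α.index i : ℕ) = α.index j → w i < w j := by
  constructor
  · intro h i j hij he
    refine α.monotone_index.rel_of_eq (r := fun a b => w a < w b) (fun _ _ _ => lt_trans) ?_ hij he
    intro a b hab hidx
    by_contra! hlt
    have hne : a ≠ b := by rintro rfl; omega
    have hlt' : w b < w a := lt_of_le_of_ne hlt fun e => hne (w.injective e.symm)
    have hmem : (b : ℕ) ∈ descentSet w := by
      simp only [descentSet, Finset.mem_filter, Finset.mem_Icc]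
      exact ⟨⟨by omega, by omega⟩, a, b, by omega, by omega, hlt'⟩
    have := (α.succ_mem_partialSumSet_iff hab).mp (h hmem)
    exact absurd hidx this.ne
  · intro h t ht
    simp only [descentSet, Finset.mem_filter] at ht
    obtain ⟨-, a, b, ha, hb, hlt⟩ := ht
    have hab : (b : ℕ) = a + 1 := by omega
    have hlt' : a < b := by rw [Fin.lt_def]; omega
    have : t = (b : ℕ) := by omega
    rw [this, α.succ_mem_partialSumSet_iff hab]
    refine lt_of_le_of_ne (α.monotone_index hlt'.le) fun e => ?_
    exact absurd (h a b hlt' e) hlt.not_gt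

end

namespace Face

variable {n : ℕ}

/-! ### Types of faces -/

theorem card_filter_key_eq (F : Face n) {i : ℕ} (hi : i < F.blocks.length) :
    (Finset.univ.filter fun x => F.key x = i).card = F.blocks[i].card := by
  rw [getElem_eq_filter]

/-- Two functions differ by a permutation of the domain exactly when corresponding fibers have equal
size. -/
theorem type_eq_iff {F : Face n} {α : Composition n} :
    F.type = α ↔ ∃ σ : Equiv.Perm (Fin n), F.key = (fun x => (α.index x : ℕ)) ∘ σ := by
  constructor
  · rintro rfl
    have hlen : F.type.length = F.blocks.length := List.length_map _
    have hcard : ∀ i, (Finset.univ.filter fun x => F.key x = i).card =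
        (Finset.univ.filter fun x => (F.type.index x : ℕ) = i).card := by
      intro i
      by_cases hi : i < F.blocks.length
      · rw [card_filter_key_eq F hi, F.type.card_filter_index_eq (hlen ▸ hi)]
        simp [type]
      · rw [Finset.filter_false_of_mem, Finset.filter_false_of_mem]
        · rintro x - rfl
          exact hi (hlen ▸ (F.type.index x).2)
        · rintro x - rfl
          exact hi (F.key_lt x)
    have e : ∀ i, {x // F.key x = i} ≃ {x // (F.type.index x : ℕ) = i} := fun i =>
      Fintype.equivOfCardEq (by rw [Fintype.card_subtype, Fintype.card_subtype, hcard])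
    exact ⟨Equiv.ofFiberEquiv e, funext fun x => (Equiv.ofFiberEquiv_map e x).symm⟩
  · rintro ⟨σ, hσ⟩
    have hlen : F.blocks.length = α.length := by
      have h1 := F.image_key
      rw [hσ, ← Finset.image_image, Finset.image_univ_equiv] at h1
      have h2 : Finset.univ.image (fun x => (α.index x : ℕ)) = Finset.range α.length := by
        ext i
        simp only [Finset.mem_image, Finset.mem_univ, true_and, Finset.mem_range]
        exact ⟨fun ⟨x, hx⟩ => hx ▸ (α.index x).2, α.exists_index_eq⟩
      simpa [length] using congrArg Finset.card (h1.symm.trans h2)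
    refine Composition.ext (List.ext_getElem ?_ fun i h1 h2 => ?_)
    · exact (List.length_map _).trans hlen
    · have h3 : i < F.blocks.length := by rw [hlen]; exact h2
      rw [← α.card_filter_index_eq h2]
      simp only [type, List.getElem_map]
      rw [← card_filter_key_eq F h3, hσ]
      refine Finset.card_equiv σ fun x => ?_
      simp

/-- Both sides are monotone rearrangements of `F.key`, and such a rearrangement is unique. -/
theorem key_comp_sort (F : Face n) :
    F.key ∘ Tuple.sort F.key = fun x => (F.type.index x : ℕ) := by
  obtain ⟨σ, hσ⟩ := type_eq_iff.mp (rfl : F.type = F.type)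
  have h : F.key ∘ ⇑σ⁻¹ = fun x => (F.type.index x : ℕ) := by
    rw [hσ]
    funext x
    simp
  rw [← Tuple.comp_sort_eq_comp_iff_monotone.mpr (h ▸ F.type.monotone_index), h]

theorem type_perm (w : Equiv.Perm (Fin n)) (F : Face n) : (F.perm w).type = F.type := by
  obtain ⟨σ, hσ⟩ := type_eq_iff.mp (rfl : F.type = F.type)
  exact type_eq_iff.mpr ⟨σ * w, by rw [key_perm, hσ]; rfl⟩

/-! ### Faces of type `α` and permutations with descents in `I(α)` -/

/-- The face whose blocks are the values of `w` on the consecutive segments of lengths `α`. -/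
def ofPerm (α : Composition n) (w : Equiv.Perm (Fin n)) : Face n :=
  ofFun ((fun x => (α.index x : ℕ)) ∘ ⇑w⁻¹)

theorem key_ofPerm (α : Composition n) (w : Equiv.Perm (Fin n)) :
    (ofPerm α w).key = (fun x => (α.index x : ℕ)) ∘ ⇑w⁻¹ := by
  refine key_ofFun fun x i hi => ?_
  obtain ⟨y, hy⟩ := α.exists_index_eq (lt_trans hi (α.index (w⁻¹ x)).2)
  exact ⟨w y, by simpa using hy⟩

theorem type_ofPerm (α : Composition n) (w : Equiv.Perm (Fin n)) : (ofPerm α w).type = α :=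
  type_eq_iff.mpr ⟨w⁻¹, key_ofPerm α w⟩

end Face

theorem Tuple.sort_spec {n : ℕ} {α : Type*} [LinearOrder α] (f : Fin n → α) {i j : Fin n}
    (hij : i < j) (h : f (Tuple.sort f i) = f (Tuple.sort f j)) :
    Tuple.sort f i < Tuple.sort f j :=
  (Tuple.eq_sort_iff.mp (rfl : Tuple.sort f = Tuple.sort f)).2 i j hij h

namespace Face

variable {n : ℕ}

theorem sort_key_ofPerm {α : Composition n} {w : Equiv.Perm (Fin n)}
    (h : descentSet w ⊆ partialSumSet α) : Tuple.sort (ofPerm α w).key = w := by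
  symm
  have hc : (ofPerm α w).key ∘ w = fun x => (α.index x : ℕ) := by
    rw [key_ofPerm]
    funext x
    simp
  rw [Tuple.eq_sort_iff]
  refine ⟨hc ▸ α.monotone_index, fun i j hij he => ?_⟩
  exact (descentSet_subset_iff w α).mp h i j hij ((congrFun hc i).symm.trans (he.trans (congrFun hc j)))

theorem ofPerm_sort_key (F : Face n) : ofPerm F.type (Tuple.sort F.key) = F := by
  apply ext_of_key
  rw [key_ofPerm, ← key_comp_sort]
  funext x
  simp

theorem descentSet_sort_key (F : Face n) :
    descentSet (Tuple.sort F.key) ⊆ partialSumSet F.type := by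
  rw [descentSet_subset_iff]
  intro i j hij he
  exact Tuple.sort_spec _ hij
    ((congrFun F.key_comp_sort i).trans (he.trans (congrFun F.key_comp_sort j).symm))

/-! ### The action of faces on permutations -/

/-- The product of a face and a chamber: the word `w`, sorted stably by the blocks of `F`. -/
def act (F : Face n) (w : Equiv.Perm (Fin n)) : Equiv.Perm (Fin n) :=
  w * Tuple.sort (F.perm w).key

/-- Radix sort: sorting stably by `G` and then stably by `F` is sorting stably by the lexicographic
pair of keys. -/
theorem act_prod (F G : Face n) (w : Equiv.Perm (Fin n)) :
    (F.prod G).act w = F.act (G.act w) := by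
  simp only [act, mul_assoc, key_perm]
  congr 1
  symm
  set s := Tuple.sort (G.key ∘ w) with hs
  have hG := Tuple.monotone_sort (G.key ∘ w)
  set t := Tuple.sort (F.key ∘ ⇑(w * s)) with ht
  have hF := Tuple.monotone_sort (F.key ∘ ⇑(w * s))
  rw [← hs] at hG
  rw [← ht] at hF
  have hle : ∀ x y, (F.prod G).key x ≤ (F.prod G).key y ↔
      F.key x < F.key y ∨ F.key x = F.key y ∧ G.key x ≤ G.key y := fun x y => by
    rw [prod, ofFun_key_le_iff, Prod.Lex.toLex_le_toLex]
  rw [Tuple.eq_sort_iff]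
  constructor
  · intro i j hij
    rcases hij.lt_or_eq with hij | rfl
    · refine (hle _ _).mpr ?_
      rcases (hF hij.le).lt_or_eq with h1 | h1
      · exact Or.inl h1
      · exact Or.inr ⟨h1, hG (Tuple.sort_spec _ hij h1).le⟩
    · exact le_rfl
  · intro i j hij he
    have h1 := (F.prod_isContained_left G)
    have h2 := (F.prod_isContained_right G)
    rw [isContained_iff] at h1 h2
    exact Tuple.sort_spec _ (Tuple.sort_spec _ hij (h1 _ _ he)) (h2 _ _ he)

/-! ### The operators of faces on the group algebra -/

variable (k : Type*) [CommRing k]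

/-- The linear extension of the action of `F`. -/
noncomputable def op (F : Face n) :
    Module.End k (MonoidAlgebra k (Equiv.Perm (Fin n))) :=
  MonoidAlgebra.mapDomainLinearMap k k F.act

theorem op_of (F : Face n) (w : Equiv.Perm (Fin n)) :
    F.op k (MonoidAlgebra.of k _ w) = MonoidAlgebra.of k _ (F.act w) := by
  simp [op]

theorem op_mul_op (F G : Face n) : F.op k * G.op k = (F.prod G).op k := by
  rw [op, op, op, Module.End.mul_eq_comp, ← MonoidAlgebra.mapDomainLinearMap_comp]
  congr 1
  exact funext fun w => (act_prod F G w).symm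

theorem end_ext {f g : Module.End k (MonoidAlgebra k (Equiv.Perm (Fin n)))}
    (h : ∀ w, f (MonoidAlgebra.of k _ w) = g (MonoidAlgebra.of k _ w)) : f = g :=
  MonoidAlgebra.lhom_ext' fun w => LinearMap.ext_ring (h w)

/-- Listing the blocks of `G` in order, each increasingly, gives a bijection from faces of type `α`
to permutations with descents in `I(α)`; its inverse is `ofPerm α`. -/
theorem sum_filter_type_eq (α : Composition n) :
    ∑ G ∈ (Finset.univ : Finset (Face n)).filter (fun G => G.type = α),
      MonoidAlgebra.of k (Equiv.Perm (Fin n)) (Tuple.sort G.key) = elemB k α := by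
  rw [elemB, elemBSet]
  refine Finset.sum_nbij' (fun G => Tuple.sort G.key) (ofPerm α) ?_ ?_ ?_ ?_ ?_
  · intro G hG
    obtain rfl := (Finset.mem_filter.mp hG).2
    exact Finset.mem_filter.mpr ⟨Finset.mem_univ _, G.descentSet_sort_key⟩
  · intro w _
    exact Finset.mem_filter.mpr ⟨Finset.mem_univ _, type_ofPerm α w⟩
  · intro G hG
    obtain rfl := (Finset.mem_filter.mp hG).2
    exact G.ofPerm_sort_key
  · intro w hw
    exact sort_key_ofPerm (Finset.mem_filter.mp hw).2
  · intro _ _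
    rfl

variable {k}

theorem weightedB_eq_sum (γ : Composition n → k) :
    weightedB γ = ∑ G : Face n, γ G.type • MonoidAlgebra.of k _ (Tuple.sort G.key) := by
  rw [weightedB, ← Finset.sum_fiberwise (Finset.univ : Finset (Face n)) type]
  refine Finset.sum_congr rfl fun α _ => ?_
  rw [← sum_filter_type_eq, Finset.smul_sum]
  refine Finset.sum_congr rfl fun G hG => ?_
  rw [(Finset.mem_filter.mp hG).2]

/-- By definition, `G.act w` is `w` times the sorting permutation of `G.perm w`. Since relabelling
preserves types, the sum may be reindexed along `permEquiv w`. -/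
theorem mulRight_weightedB (γ : Composition n → k) :
    LinearMap.mulRight k (weightedB γ) = ∑ G : Face n, γ G.type • G.op k := by
  refine end_ext k fun w => ?_
  rw [LinearMap.mulRight_apply, weightedB_eq_sum, Finset.mul_sum, LinearMap.sum_apply,
    ← (permEquiv w).sum_comp]
  refine Finset.sum_congr rfl fun G _ => ?_
  rw [LinearMap.smul_apply, op_of, act, map_mul, mul_smul_comm]
  simp only [permEquiv, Equiv.coe_fn_mk, type_perm]

end Face

section

variable {n : ℕ}

/-! ### Positions at which a monotone function does not increase -/

/-- The positions `a` such that `g` takes the same value at `a` and at the next position. -/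
def ties (g : Fin n → ℕ) : Finset (Fin n) :=
  Finset.univ.filter fun a => ∃ b : Fin n, (b : ℕ) = a + 1 ∧ g a = g b

theorem mem_ties_iff (g : Fin n → ℕ) {a b : Fin n} (hab : (b : ℕ) = a + 1) :
    a ∈ ties g ↔ g a = g b := by
  simp only [ties, Finset.mem_filter, Finset.mem_univ, true_and]
  refine ⟨?_, fun h => ⟨b, hab, h⟩⟩
  rintro ⟨c, hc, h⟩
  rwa [Fin.ext (hab.trans hc.symm)]

/-- The positions that are not ties are the last positions of the fibers of `g`, one for each value.
-/
theorem Monotone.card_image_add_card_ties {g : Fin n → ℕ} (hg : Monotone g) :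
    (Finset.univ.image g).card + (ties g).card = n := by
  have himg : Finset.univ.image g = (ties g)ᶜ.image g := by
    refine Finset.Subset.antisymm (fun i hi => ?_) (Finset.image_subset_image (Finset.subset_univ _))
    obtain ⟨x, -, rfl⟩ := Finset.mem_image.mp hi
    obtain ⟨y, hy, hmax⟩ := (Finset.univ.filter fun y => g y = g x).exists_max_image id ⟨x, by simp⟩
    have hyx : g y = g x := (Finset.mem_filter.mp hy).2
    refine Finset.mem_image.mpr ⟨y, ?_, hyx⟩
    rw [Finset.mem_compl, ties, Finset.mem_filter]
    rintro ⟨-, b, hb, hgb⟩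
    have h1 : b ≤ y := hmax b (by simp [← hgb, hyx])
    have h2 : (b : ℕ) ≤ y := h1
    omega
  have hinj : Set.InjOn g ((ties g)ᶜ : Finset (Fin n)) := by
    have key : ∀ a ∈ (ties g)ᶜ, ∀ b, a < b → g a ≠ g b := by
      intro a ha b hab he
      have hab' : (a : ℕ) < b := hab
      have h1 : g a ≤ g ⟨a + 1, by omega⟩ := hg (Nat.le_succ (a : ℕ))
      have h2 : g ⟨a + 1, by omega⟩ ≤ g b := hg hab'
      rw [Finset.mem_compl, mem_ties_iff g (b := ⟨a + 1, by omega⟩) rfl] at ha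
      omega
    intro a ha b hb he
    rcases lt_trichotomy a b with h | h | h
    · exact absurd he (key a ha b h)
    · exact h
    · exact absurd he.symm (key b hb a h)
  rw [himg, Finset.card_image_of_injOn hinj, Finset.card_compl_add_card, Fintype.card_fin]

theorem Monotone.le_of_ties_subset {g h : Fin n → ℕ} (hg : Monotone g) (hh : Monotone h)
    (hgh : ties g ⊆ ties h) {x y : Fin n} (hxy : g x ≤ g y) : h x ≤ h y := by
  rcases le_or_gt x y with h1 | h1
  · exact hh h1
  · refine (hg.rel_of_eq (r := fun a b => h a = h b) (fun _ _ _ => Eq.trans) ?_ h1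
      (le_antisymm (hg h1.le) hxy)).ge
    intro a b hab he
    exact (mem_ties_iff h hab).mp (hgh ((mem_ties_iff g hab).mpr he))

/-- The function that increases by one after each position outside of `L`. -/
def stepFun (L : Finset (Fin n)) (x : Fin n) : ℕ := (Lᶜ.filter fun t => t < x).card

theorem monotone_stepFun (L : Finset (Fin n)) : Monotone (stepFun L) := fun _ _ hxy =>
  Finset.card_le_card (Finset.monotone_filter_right _ fun _ _ ht => lt_of_lt_of_le ht hxy)

theorem stepFun_eq_iff (L : Finset (Fin n)) {a b : Fin n} (hab : (b : ℕ) = a + 1) :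
    stepFun L a = stepFun L b ↔ a ∈ L := by
  have hlt : a < b := by rw [Fin.lt_def]; omega
  constructor
  · intro h
    by_contra ha
    refine absurd h (Finset.card_lt_card ?_).ne
    refine Finset.ssubset_iff_of_subset (Finset.monotone_filter_right _ fun _ _ ht => lt_trans ht hlt)
      |>.mpr ⟨a, by simp [ha, hlt], by simp⟩
  · intro ha
    refine congrArg Finset.card (Finset.filter_congr fun t ht => ?_)
    have hne : t ≠ a := by rintro rfl; exact (Finset.mem_compl.mp ht) ha
    have hne' : (t : ℕ) ≠ a := fun e => hne (Fin.ext e)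
    rw [Fin.lt_def, Fin.lt_def]
    omega

end

namespace Face

variable {n : ℕ}

/-! ### Reversal of chambers -/

theorem sort_key_eq_iff {H : Face n} {D : Equiv.Perm (Fin n)} :
    Tuple.sort H.key = D ↔ Monotone (H.key ∘ D) ∧
      ∀ a b : Fin n, (b : ℕ) = a + 1 → a ∈ ties (H.key ∘ D) → D a < D b := by
  rw [eq_comm, Tuple.eq_sort_iff]
  refine and_congr_right fun hm => ⟨fun h a b hab ha => ?_, fun h i j hij he => ?_⟩
  · exact h a b (by rw [Fin.lt_def]; omega) ((mem_ties_iff _ hab).mp ha)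
  · exact hm.rel_of_eq (r := fun a b => D a < D b) (fun _ _ _ => lt_trans)
      (fun a b hab he => h a b hab ((mem_ties_iff _ hab).mpr he)) hij he

/-- Conjugating the order by `w₀` reverses how ties are broken: this permutation lists the blocks of
`F` in order, each decreasingly. -/
theorem eq_longestWord_mul_sort_iff {F : Face n} {D : Equiv.Perm (Fin n)} :
    D = longestWord n * Tuple.sort (F.key ∘ longestWord n) ↔ Monotone (F.key ∘ D) ∧
      ∀ a b : Fin n, (b : ℕ) = a + 1 → a ∈ ties (F.key ∘ D) → D b < D a := by
  have hinv : (longestWord n)⁻¹ = longestWord n := rfl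
  rw [← inv_mul_eq_iff_eq_mul, hinv, Tuple.eq_sort_iff]
  have hc : (F.key ∘ longestWord n) ∘ ⇑(longestWord n * D) = F.key ∘ D := by
    funext x
    simp [longestWord]
  have hlt : ∀ i j, (longestWord n * D) i < (longestWord n * D) j ↔ D j < D i := fun i j => by
    simp [longestWord, Fin.rev_lt_rev]
  rw [hc]
  refine and_congr_right fun hm => ⟨fun h a b hab ha => ?_, fun h i j hij he => ?_⟩
  · rw [← hlt]
    exact h a b (by rw [Fin.lt_def]; omega)
      ((congrFun hc a).trans (((mem_ties_iff _ hab).mp ha).trans (congrFun hc b).symm))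
  · rw [hlt]
    have he' := (congrFun hc i).symm.trans (he.trans (congrFun hc j))
    exact hm.rel_of_eq (r := fun a b => D b < D a) (fun _ _ _ h1 h2 => h2.trans h1)
      (fun a b hab he => h a b hab ((mem_ties_iff _ hab).mpr he)) hij he'

/-- With the elements listed in the order `D`, the face `H` is given by its cuts, and coarsening it
means dropping cuts, that is, adding ties. -/
theorem refines_iff_ties_subset {F H : Face n} {D : Equiv.Perm (Fin n)}
    (hH : Monotone (H.key ∘ D)) :
    H.Refines F ↔ Monotone (F.key ∘ D) ∧ ties (H.key ∘ D) ⊆ ties (F.key ∘ D) := by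
  constructor
  · intro h
    refine ⟨fun i j hij => h _ _ (hH hij), fun a ha => ?_⟩
    simp only [ties, Finset.mem_filter, Finset.mem_univ, true_and] at ha ⊢
    obtain ⟨b, hb, he⟩ := ha
    exact ⟨b, hb, le_antisymm (h _ _ he.le) (h _ _ he.ge)⟩
  · rintro ⟨hF, hsub⟩ x y hxy
    have := hH.le_of_ties_subset hF hsub (x := D⁻¹ x) (y := D⁻¹ y) (by simpa using hxy)
    simpa using this

theorem sub_length_eq_card_ties {H : Face n} {D : Equiv.Perm (Fin n)}
    (hH : Monotone (H.key ∘ D)) : n - H.length = (ties (H.key ∘ D)).card := by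
  have h := hH.card_image_add_card_ties
  rw [← Finset.image_image, Finset.image_univ_equiv, ← length_eq_card_image_key] at h
  omega

/-- The face whose blocks are the values of `D` on the segments of consecutive positions that
arise by cutting after each position outside of `L`. -/
def cutFace (D : Equiv.Perm (Fin n)) (L : Finset (Fin n)) : Face n := ofFun (stepFun L ∘ ⇑D⁻¹)

theorem key_cutFace_le_iff (D : Equiv.Perm (Fin n)) (L : Finset (Fin n)) (x y : Fin n) :
    ((cutFace D L).key ∘ D) x ≤ ((cutFace D L).key ∘ D) y ↔ stepFun L x ≤ stepFun L y := by
  simp [cutFace, ofFun_key_le_iff]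

theorem monotone_key_cutFace (D : Equiv.Perm (Fin n)) (L : Finset (Fin n)) :
    Monotone ((cutFace D L).key ∘ D) :=
  fun x y hxy => (key_cutFace_le_iff D L x y).mpr (monotone_stepFun L hxy)

variable (k : Type*) [CommRing k]

/-- If `D` lists the blocks of `F` in order, the faces `H` in the sum correspond, via their ties, to
the subsets of the set `T` of ties of `F` at which `D` ascends, and `n - H.length` is the size of
the subset. The alternating sum over subsets vanishes unless `T` is empty, that is, unless `D`
decreases on every block of `F`. -/
theorem sum_refines_sort_eq (F : Face n) (D : Equiv.Perm (Fin n)) :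
    ∑ H ∈ (Finset.univ : Finset (Face n)).filter (fun H => H.Refines F ∧ Tuple.sort H.key = D),
      (-1 : k) ^ (n - H.length) =
    if D = longestWord n * Tuple.sort (F.key ∘ longestWord n) then 1 else 0 := by
  by_cases hF : Monotone (F.key ∘ D)
  · let T := (ties (F.key ∘ D)).filter fun a : Fin n =>
      ∀ b : Fin n, (b : ℕ) = a + 1 → D a < D b
    have hties : ∀ L ⊆ ties (F.key ∘ D), ties ((cutFace D L).key ∘ D) = L := by
      intro L hL
      ext a
      by_cases ha : ∃ b : Fin n, (b : ℕ) = a + 1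
      · obtain ⟨b, hb⟩ := ha
        rw [mem_ties_iff _ hb, ← stepFun_eq_iff L hb, le_antisymm_iff, le_antisymm_iff,
          key_cutFace_le_iff, key_cutFace_le_iff]
      -- The last position has no successor, so it is never a tie and does not lie in `L` either.
      · refine iff_of_false (fun h => ?_) fun h => ?_
        · obtain ⟨-, b, hb, -⟩ := Finset.mem_filter.mp h
          exact ha ⟨b, hb⟩
        · obtain ⟨-, b, hb, -⟩ := Finset.mem_filter.mp (hL h)
          exact ha ⟨b, hb⟩
    have hsum : ∑ H ∈ (Finset.univ : Finset (Face n)).filter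
        (fun H => H.Refines F ∧ Tuple.sort H.key = D), (-1 : k) ^ (n - H.length) =
        ∑ L ∈ T.powerset, (-1 : k) ^ L.card := by
      refine Finset.sum_nbij' (fun H => ties (H.key ∘ D)) (cutFace D)
        ?_ ?_ ?_ ?_ ?_
      · intro H hH
        obtain ⟨-, hr, hs⟩ := Finset.mem_filter.mp hH
        obtain ⟨hm, ht⟩ := sort_key_eq_iff.mp hs
        refine Finset.mem_powerset.mpr fun a ha => Finset.mem_filter.mpr ⟨?_, fun b hb => ht a b hb ha⟩
        exact ((refines_iff_ties_subset hm).mp hr).2 ha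
      · intro L hL
        have hLT := Finset.mem_powerset.mp hL
        have hLF : L ⊆ ties (F.key ∘ D) := hLT.trans (Finset.filter_subset _ _)
        refine Finset.mem_filter.mpr ⟨Finset.mem_univ _, ?_, ?_⟩
        · rw [refines_iff_ties_subset (monotone_key_cutFace D L), hties L hLF]
          exact ⟨hF, hLF⟩
        · rw [sort_key_eq_iff, hties L hLF]
          exact ⟨monotone_key_cutFace D L, fun a b hab ha => (Finset.mem_filter.mp (hLT ha)).2 b hab⟩
      · intro H hH
        obtain ⟨-, hr, hs⟩ := Finset.mem_filter.mp hH
        obtain ⟨hm, ht⟩ := sort_key_eq_iff.mp hs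
        have hst : ties (stepFun (ties (H.key ∘ D))) = ties (H.key ∘ D) := by
          ext a
          by_cases ha : ∃ b : Fin n, (b : ℕ) = a + 1
          · obtain ⟨b, hb⟩ := ha
            rw [mem_ties_iff _ hb, stepFun_eq_iff _ hb]
          · refine iff_of_false (fun h => ?_) fun h => ?_ <;>
            · obtain ⟨-, b, hb, -⟩ := Finset.mem_filter.mp h
              exact ha ⟨b, hb⟩
        rw [cutFace, ofFun_eq_iff]
        intro x y
        constructor
        · intro h
          have := (monotone_stepFun _).le_of_ties_subset hm hst.subset h
          simpa using this
        · intro h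
          exact hm.le_of_ties_subset (monotone_stepFun _) hst.superset (by simpa using h)
      · intro L hL
        exact hties L ((Finset.mem_powerset.mp hL).trans (Finset.filter_subset _ _))
      · intro H hH
        obtain ⟨-, -, hs⟩ := Finset.mem_filter.mp hH
        rw [sub_length_eq_card_ties (sort_key_eq_iff.mp hs).1]
    have hpow := congrArg (Int.cast : ℤ → k) (Finset.sum_powerset_neg_one_pow_card (x := T))
    push_cast at hpow
    rw [hsum, hpow]
    refine if_congr ?_ rfl rfl
    rw [eq_longestWord_mul_sort_iff, Finset.filter_eq_empty_iff]
    refine ⟨fun h => ⟨hF, fun a b hab ha => ?_⟩, fun h a ha hlt => ?_⟩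
    · by_contra hcon
      refine h ha fun c hc => ?_
      obtain rfl : c = b := Fin.ext (hc.trans hab.symm)
      refine lt_of_le_of_ne (not_lt.mp hcon) fun e => ?_
      have := congrArg Fin.val (D.injective e)
      omega
    · obtain ⟨-, b, hb, -⟩ := Finset.mem_filter.mp ha
      exact absurd (hlt b hb) (h.2 a b hb ha).not_gt
  · rw [if_neg fun h => hF (eq_longestWord_mul_sort_iff.mp h).1, Finset.filter_false_of_mem,
      Finset.sum_empty]
    rintro H - ⟨hr, hs⟩
    exact hF ((refines_iff_ties_subset (sort_key_eq_iff.mp hs).1).mp hr).1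

theorem sum_refines_of_sort (F : Face n) :
    ∑ H ∈ (Finset.univ : Finset (Face n)).filter (fun H => H.Refines F),
      (-1 : k) ^ (n - H.length) • MonoidAlgebra.of k (Equiv.Perm (Fin n)) (Tuple.sort H.key) =
    MonoidAlgebra.of k _ (longestWord n * Tuple.sort (F.key ∘ longestWord n)) := by
  rw [← Finset.sum_fiberwise _ fun H : Face n => Tuple.sort H.key]
  have h : ∀ D : Equiv.Perm (Fin n),
      ∑ H ∈ ((Finset.univ : Finset (Face n)).filter fun H => H.Refines F).filter
        (fun H => Tuple.sort H.key = D),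
        (-1 : k) ^ (n - H.length) • MonoidAlgebra.of k (Equiv.Perm (Fin n)) (Tuple.sort H.key) =
      (if D = longestWord n * Tuple.sort (F.key ∘ longestWord n) then (1 : k) else 0) •
        MonoidAlgebra.of k _ D := by
    intro D
    rw [← sum_refines_sort_eq k F D, Finset.filter_filter, Finset.sum_smul]
    exact Finset.sum_congr rfl fun H hH => by rw [(Finset.mem_filter.mp hH).2.2]
  simp only [h, ite_smul, one_smul, zero_smul, Finset.sum_ite_eq', Finset.mem_univ, if_true]

/-- Relabelling by `w` turns the claim at `w` into `sum_refines_of_sort` for `F.perm w`; it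
preserves refinement and length. -/
theorem op_mul_mulRight_longestWord (F : Face n) :
    F.op k * LinearMap.mulRight k (MonoidAlgebra.of k _ (longestWord n)) =
      ∑ H ∈ (Finset.univ : Finset (Face n)).filter (fun H => H.Refines F),
        (-1 : k) ^ (n - H.length) • H.op k := by
  refine end_ext k fun w => ?_
  rw [Module.End.mul_apply, LinearMap.mulRight_apply, ← map_mul, op_of, act, LinearMap.sum_apply]
  have h := congrArg (MonoidAlgebra.of k _ w * ·) (sum_refines_of_sort k (F.perm w))
  simp only [Finset.mul_sum, mul_smul_comm, ← map_mul] at h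
  rw [mul_assoc, key_perm, Equiv.Perm.coe_mul, ← Function.comp_assoc, ← key_perm, ← h]
  refine (Finset.sum_equiv (permEquiv w) (fun H => ?_) fun H _ => ?_).symm
  · simp only [Finset.mem_filter, Finset.mem_univ, true_and]
    exact perm_refines_iff.symm
  · rw [LinearMap.smul_apply, op_of, act]
    simp only [permEquiv, Equiv.coe_fn_mk, length_perm]

end Face

namespace Face

variable {n : ℕ} {k : Type*} [CommRing k] {γ : Composition n → k}

/-! ### Unsigned knapsack numbers -/

/-- The weighted unsigned knapsack number `∑_α γ_α n_α(F)`, as a sum over the faces containing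
`F`. -/
def weight (γ : Composition n → k) (F : Face n) : k :=
  ∑ G ∈ (Finset.univ : Finset (Face n)).filter (fun G => F.IsContained G), γ G.type

theorem weightedSignedKnapsack_eq (γ : Composition n → k) (F : Face n) :
    weightedSignedKnapsack γ F = (((-1) ^ (n - F.length) : ℤ) : k) * weight γ F := by
  rw [weight, ← Finset.sum_fiberwise _ type, Finset.mul_sum, weightedSignedKnapsack]
  refine Finset.sum_congr rfl fun α _ => ?_
  rw [Finset.filter_filter, Finset.sum_congr rfl fun G hG => by
    rw [(Finset.mem_filter.mp hG).2.2], Finset.sum_const, signedKnapsack, knapsack]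
  push_cast
  rw [nsmul_eq_mul]
  ring

/-! ### The filtration by unsigned knapsack numbers -/

/-- The span of the operators of the faces whose unsigned knapsack number lies in `S`. -/
noncomputable def opSpan (γ : Composition n → k) (S : Set k) :
    Submodule k (Module.End k (MonoidAlgebra k (Equiv.Perm (Fin n)))) :=
  Submodule.span k ((fun F => F.op k) '' {F | weight γ F ∈ S})

theorem op_mem_opSpan {S : Set k} {F : Face n} (h : weight γ F ∈ S) : F.op k ∈ opSpan γ S :=
  Submodule.subset_span ⟨F, h, rfl⟩

theorem opSpan_mono {S T : Set k} (h : S ⊆ T) : opSpan γ S ≤ opSpan γ T :=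
  Submodule.span_mono (Set.image_mono fun _ hF => h hF)

/-- Membership in a submodule of a linear expression in `y` may be checked on generators. -/
theorem map_mem_of_mem_opSpan {S : Set k}
    {f : Module.End k (Module.End k (MonoidAlgebra k (Equiv.Perm (Fin n))))}
    {V : Submodule k (Module.End k (MonoidAlgebra k (Equiv.Perm (Fin n))))}
    (h : ∀ F : Face n, weight γ F ∈ S → f (F.op k) ∈ V)
    {y : Module.End k (MonoidAlgebra k (Equiv.Perm (Fin n)))} (hy : y ∈ opSpan γ S) : f y ∈ V := by
  have : opSpan γ S ≤ V.comap f := by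
    rw [opSpan, Submodule.span_le]
    rintro _ ⟨F, hF, rfl⟩
    exact h F hF
  exact this hy

section Ordered

variable [LinearOrder k] [IsOrderedRing k]

theorem weight_nonneg (hγ : ∀ α, 0 ≤ γ α) (F : Face n) : 0 ≤ weight γ F :=
  Finset.sum_nonneg fun _ _ => hγ _

theorem filter_isContained_subset {F H : Face n} (h : H.IsContained F) :
    (Finset.univ : Finset (Face n)).filter (fun G => F.IsContained G) ⊆
      Finset.univ.filter fun G => H.IsContained G :=
  Finset.monotone_filter_right _ fun _ _ => h.trans

theorem weight_le_of_isContained (hγ : ∀ α, 0 ≤ γ α) {F H : Face n} (h : H.IsContained F) :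
    weight γ F ≤ weight γ H :=
  Finset.sum_le_sum_of_subset_of_nonneg (filter_isContained_subset h) fun _ _ _ => hγ _

/-- The face `G` contributes to the weight of `H` but not to that of `F`. -/
theorem weight_lt_of_isContained (hγ : ∀ α, 0 ≤ γ α) {F G H : Face n} (hF : H.IsContained F)
    (hG : H.IsContained G) (hFG : ¬ F.IsContained G) (hpos : γ G.type ≠ 0) :
    weight γ F < weight γ H :=
  Finset.sum_lt_sum_of_subset (filter_isContained_subset hF) (i := G) (by simpa using hG)
    (by simpa using hFG) (lt_of_le_of_ne (hγ _) hpos.symm) fun _ _ _ => hγ _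

/-- The faces `G` containing `F` satisfy `F.prod G = F` and together contribute `weight γ F • F.op
k`. For any other `G` with nonzero coefficient, `F.prod G` is contained in `G` while `F` is not, so
its weight is strictly larger. -/
theorem op_mul_mulRight_weightedB_sub_mem (hγ : ∀ α, 0 ≤ γ α) (F : Face n) :
    F.op k * LinearMap.mulRight k (weightedB γ) - weight γ F • F.op k ∈
      opSpan γ (Set.Ioi (weight γ F)) := by
  have h : F.op k * LinearMap.mulRight k (weightedB γ) - weight γ F • F.op k =
      ∑ G ∈ (Finset.univ : Finset (Face n)).filter (fun G => ¬ F.IsContained G),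
        γ G.type • (F.prod G).op k := by
    have h1 : ∑ G ∈ (Finset.univ : Finset (Face n)).filter (fun G => F.IsContained G),
        γ G.type • (F.prod G).op k = weight γ F • F.op k := by
      rw [weight, Finset.sum_smul]
      exact Finset.sum_congr rfl fun G hG => by rw [prod_eq_left (Finset.mem_filter.mp hG).2]
    have h2 := Finset.sum_filter_add_sum_filter_not Finset.univ (fun G => F.IsContained G)
      fun G => γ G.type • (F.prod G).op k
    have h3 : F.op k * LinearMap.mulRight k (weightedB γ) =
        ∑ G : Face n, γ G.type • (F.prod G).op k := by
      rw [mulRight_weightedB, Finset.mul_sum]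
      exact Finset.sum_congr rfl fun G _ => by rw [mul_smul_comm, op_mul_op]
    rw [h3, ← h2, h1, add_sub_cancel_left]
  rw [h]
  refine Submodule.sum_mem _ fun G hG => ?_
  by_cases h0 : γ G.type = 0
  · rw [h0, zero_smul]
    exact Submodule.zero_mem _
  · exact Submodule.smul_mem _ _ (op_mem_opSpan (weight_lt_of_isContained hγ
      (prod_isContained_left F G) (prod_isContained_right F G) (Finset.mem_filter.mp hG).2 h0))

theorem op_mul_mulRight_longestWord_mem (hγ : ∀ α, 0 ≤ γ α) (F : Face n) :
    F.op k * LinearMap.mulRight k (MonoidAlgebra.of k _ (longestWord n)) ∈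
      opSpan γ (Set.Ici (weight γ F)) := by
  rw [op_mul_mulRight_longestWord]
  exact Submodule.sum_mem _ fun H hH => Submodule.smul_mem _ _ (op_mem_opSpan
    (weight_le_of_isContained hγ (Finset.mem_filter.mp hH).2.isContained))

/-- If all faces with the same unsigned knapsack number as `F` have the same sign, then the longest
word acts as this sign, up to faces with a larger number. -/
theorem op_mul_mulRight_longestWord_sub_mem (hγ : ∀ α, 0 ≤ γ α) (F : Face n)
    (hsign : ∀ G : Face n, weight γ G = weight γ F →
      (-1 : ℤ) ^ (n - G.length) = (-1) ^ (n - F.length)) :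
    F.op k * LinearMap.mulRight k (MonoidAlgebra.of k _ (longestWord n)) -
      (((-1) ^ (n - F.length) : ℤ) : k) • F.op k ∈ opSpan γ (Set.Ioi (weight γ F)) := by
  have hF : F ∈ (Finset.univ : Finset (Face n)).filter fun H => H.Refines F :=
    Finset.mem_filter.mpr ⟨Finset.mem_univ _, Refines.refl F⟩
  rw [op_mul_mulRight_longestWord, ← Finset.add_sum_erase _ _ hF]
  push_cast
  rw [add_sub_cancel_left]
  refine Submodule.sum_mem _ fun H hH => Submodule.smul_mem _ _ (op_mem_opSpan ?_)
  obtain ⟨hne, hH⟩ := Finset.mem_erase.mp hH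
  have hr := (Finset.mem_filter.mp hH).2
  refine lt_of_le_of_ne (weight_le_of_isContained hγ hr.isContained) fun he => ?_
  -- If `H` had the weight of `F`, so would this intermediate face `G`, squeezed between them; but
  -- its length has the opposite parity, which contradicts `hsign`.
  obtain ⟨G, hHG, hGF, hlen⟩ := hr.exists_length_eq_succ hne
  have hG := hsign G (le_antisymm ((weight_le_of_isContained hγ hHG).trans he.ge)
    (weight_le_of_isContained hγ hGF))
  have hle := G.length_le
  rw [show n - F.length = (n - G.length) + 1 by omega, pow_succ] at hG
  rcases neg_one_pow_eq_or ℤ (n - G.length) with h | h <;> rw [h] at hG <;> norm_num at hG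

/-! ### Stability of the filtration under right multiplications -/

section Stability

variable {S : Set k} {y : Module.End k (MonoidAlgebra k (Equiv.Perm (Fin n)))}

theorem mul_mulRight_longestWord_mem (hγ : ∀ α, 0 ≤ γ α) (hS : IsUpperSet S)
    (hy : y ∈ opSpan γ S) :
    y * LinearMap.mulRight k (MonoidAlgebra.of k _ (longestWord n)) ∈ opSpan γ S :=
  map_mem_of_mem_opSpan (f := LinearMap.mulRight k _) (fun F hF =>
    opSpan_mono (hS.Ici_subset hF) (op_mul_mulRight_longestWord_mem hγ F)) hy

theorem mul_mulRight_weightedB_mem (hγ : ∀ α, 0 ≤ γ α) (hS : IsUpperSet S)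
    (hy : y ∈ opSpan γ S) : y * LinearMap.mulRight k (weightedB γ) ∈ opSpan γ S := by
  refine map_mem_of_mem_opSpan (f := LinearMap.mulRight k _) (fun F hF => ?_) hy
  have h := opSpan_mono (hS.Ioi_subset hF) (op_mul_mulRight_weightedB_sub_mem hγ F)
  exact (Submodule.sub_mem_iff_left _ (Submodule.smul_mem _ _ (op_mem_opSpan hF))).mp h

theorem mul_mulRight_weightedB_sub_mem (hγ : ∀ α, 0 ≤ γ α) {μ : k}
    (hy : y ∈ opSpan γ (Set.Ici μ)) :
    y * LinearMap.mulRight k (weightedB γ) - μ • y ∈ opSpan γ (Set.Ioi μ) := by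
  refine map_mem_of_mem_opSpan
    (f := LinearMap.mulRight k (LinearMap.mulRight k (weightedB γ)) - μ • LinearMap.id)
    (fun F hF => ?_) hy
  rcases (Set.mem_Ici.mp hF).eq_or_lt with h | h
  · rw [h]
    exact op_mul_mulRight_weightedB_sub_mem hγ F
  · have hF' := op_mem_opSpan (γ := γ) (F := F) (Set.mem_Ioi.mpr h)
    exact Submodule.sub_mem _ (mul_mulRight_weightedB_mem hγ (isUpperSet_Ioi μ) hF')
      (Submodule.smul_mem _ _ hF')

end Stability

/-! ### Annihilation of the layers -/

end Ordered

theorem mulRight_longestWord_mul_self :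
    LinearMap.mulRight k (MonoidAlgebra.of k (Equiv.Perm (Fin n)) (longestWord n)) *
      LinearMap.mulRight k (MonoidAlgebra.of k _ (longestWord n)) = 1 := by
  have h : longestWord n * longestWord n = 1 := by
    ext
    simp [longestWord]
  rw [Module.End.mul_eq_comp, ← LinearMap.mulRight_mul, ← map_mul, h, map_one]
  exact LinearMap.mulRight_one _ _

/-- `t` is the product, in either order, of right multiplication by the longest word and right
multiplication by `B_γ`. -/
def IsLongestWordProduct (γ : Composition n → k)
    (t : Module.End k (MonoidAlgebra k (Equiv.Perm (Fin n)))) : Prop :=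
  t = LinearMap.mulRight k (MonoidAlgebra.of k _ (longestWord n)) *
    LinearMap.mulRight k (weightedB γ) ∨
  t = LinearMap.mulRight k (weightedB γ) *
    LinearMap.mulRight k (MonoidAlgebra.of k _ (longestWord n))

variable [LinearOrder k] [IsOrderedRing k]

section Annihilation

variable {y t : Module.End k (MonoidAlgebra k (Equiv.Perm (Fin n)))}

namespace IsLongestWordProduct

theorem mul_mem (ht : IsLongestWordProduct γ t) (hγ : ∀ α, 0 ≤ γ α) {S : Set k}
    (hS : IsUpperSet S) (hy : y ∈ opSpan γ S) : y * t ∈ opSpan γ S := by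
  rcases ht with rfl | rfl <;> rw [← mul_assoc]
  · exact mul_mulRight_weightedB_mem hγ hS (mul_mulRight_longestWord_mem hγ hS hy)
  · exact mul_mulRight_longestWord_mem hγ hS (mul_mulRight_weightedB_mem hγ hS hy)

theorem mul_aeval_mem (ht : IsLongestWordProduct γ t) (hγ : ∀ α, 0 ≤ γ α) {S : Set k}
    (hS : IsUpperSet S) (hy : y ∈ opSpan γ S) (p : Polynomial k) :
    y * Polynomial.aeval t p ∈ opSpan γ S := by
  induction p using Polynomial.induction_on' with
  | add p q hp hq =>
    rw [map_add, mul_add]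
    exact Submodule.add_mem _ hp hq
  | monomial i c =>
    rw [Polynomial.aeval_monomial, ← mul_assoc, ← Algebra.commutes, mul_assoc,
      ← Algebra.smul_def]
    refine Submodule.smul_mem _ _ ?_
    induction i with
    | zero => simpa using hy
    | succ i ih =>
      rw [pow_succ, ← mul_assoc]
      exact ht.mul_mem hγ hS ih

/-- Right multiplication by `B_γ` is the scalar `μ` on this layer and the one by `w₀` preserves the
filtration, so the order of the two factors is irrelevant here. -/
theorem mul_sub_mem (ht : IsLongestWordProduct γ t) (hγ : ∀ α, 0 ≤ γ α) {μ : k}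
    (hy : y ∈ opSpan γ (Set.Ici μ)) :
    y * t - μ • (y * LinearMap.mulRight k (MonoidAlgebra.of k _ (longestWord n))) ∈
      opSpan γ (Set.Ioi μ) := by
  rcases ht with rfl | rfl <;> rw [← mul_assoc]
  · exact mul_mulRight_weightedB_sub_mem hγ (mul_mulRight_longestWord_mem hγ (isUpperSet_Ici μ) hy)
  · rw [← smul_mul_assoc, ← sub_mul]
    exact mul_mulRight_longestWord_mem hγ (isUpperSet_Ioi μ)
      (mul_mulRight_weightedB_sub_mem hγ hy)

/-- Applying `mul_sub_mem` twice gives `μ²` times the square of right multiplication by `w₀`, which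
is the identity. -/
theorem mul_mul_sub_mem (ht : IsLongestWordProduct γ t) (hγ : ∀ α, 0 ≤ γ α) {μ : k}
    (hy : y ∈ opSpan γ (Set.Ici μ)) :
    y * t * t - (μ * μ) • y ∈ opSpan γ (Set.Ioi μ) := by
  have h1 := ht.mul_sub_mem hγ (ht.mul_mem hγ (isUpperSet_Ici μ) hy)
  have h2 := Submodule.smul_mem _ μ
    (mul_mulRight_longestWord_mem hγ (isUpperSet_Ioi μ) (ht.mul_sub_mem hγ hy))
  have h3 := Submodule.add_mem _ h1 h2
  rw [sub_mul, smul_mul_assoc, mul_assoc y (LinearMap.mulRight k _),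
    mulRight_longestWord_mul_self, mul_one, smul_sub, smul_smul, sub_add_sub_cancel] at h3
  exact h3

open Polynomial in
-- A single linear factor suffices if the layer has only one sign, or if its weight is zero.
-- Otherwise both `±weight γ F` occur as roots, and their two factors multiply to `X² - (weight γ
-- F)²`.
theorem op_mul_aeval_layer_mem (ht : IsLongestWordProduct γ t) (hγ : ∀ α, 0 ≤ γ α) (F : Face n) :
    F.op k * aeval t (∏ κ ∈ ((Finset.univ : Finset (Face n)).image
      (weightedSignedKnapsack γ)).filter (fun κ => |κ| = weight γ F), (X - C κ)) ∈
      opSpan γ (Set.Ioi (weight γ F)) := by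
  set K := ((Finset.univ : Finset (Face n)).image (weightedSignedKnapsack γ)).filter
    (fun κ => |κ| = weight γ F)
  have hmem : ∀ G : Face n, weight γ G = weight γ F → weightedSignedKnapsack γ G ∈ K := by
    intro G hG
    refine Finset.mem_filter.mpr ⟨Finset.mem_image_of_mem _ (Finset.mem_univ _), ?_⟩
    rw [weightedSignedKnapsack_eq, ← hG]
    rcases neg_one_pow_eq_or ℤ (n - G.length) with h | h <;> rw [h] <;>
      simp [abs_of_nonneg (weight_nonneg hγ G)]
  have habs : ∀ κ ∈ K, |κ| = weight γ F := fun κ hκ => (Finset.mem_filter.mp hκ).2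
  clear_value K
  have hy := op_mem_opSpan (γ := γ) (S := Set.Ici (weight γ F)) (F := F) (Set.mem_Ici.mpr le_rfl)
  -- The remaining factors do no harm, since polynomials in `t` preserve the filtration.
  suffices h : ∃ p : k[X], p ∣ ∏ κ ∈ K, (X - C κ) ∧
      F.op k * aeval t p ∈ opSpan γ (Set.Ioi (weight γ F)) by
    obtain ⟨p, ⟨q, hq⟩, hp⟩ := h
    rw [hq, map_mul, ← mul_assoc]
    exact ht.mul_aeval_mem hγ (isUpperSet_Ioi _) hp q
  by_cases hsign : ∀ G : Face n, weight γ G = weight γ F →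
      (-1 : ℤ) ^ (n - G.length) = (-1) ^ (n - F.length)
  · refine ⟨X - C (weightedSignedKnapsack γ F), Finset.dvd_prod_of_mem (fun κ => X - C κ) (hmem F rfl), ?_⟩
    have h1 := ht.mul_sub_mem hγ hy
    have h2 := Submodule.smul_mem _ (weight γ F) (op_mul_mulRight_longestWord_sub_mem hγ F hsign)
    have h3 := Submodule.add_mem _ h1 h2
    rw [smul_sub, sub_add_sub_cancel, smul_smul, mul_comm, ← weightedSignedKnapsack_eq] at h3
    rwa [map_sub, aeval_X, aeval_C, mul_sub, ← Algebra.commutes, ← Algebra.smul_def]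
  · push Not at hsign
    obtain ⟨G, hG, hne⟩ := hsign
    have hκ : weightedSignedKnapsack γ G = - weightedSignedKnapsack γ F := by
      rw [weightedSignedKnapsack_eq, weightedSignedKnapsack_eq, hG]
      rcases neg_one_pow_eq_or ℤ (n - G.length) with h | h <;>
      rcases neg_one_pow_eq_or ℤ (n - F.length) with h' | h' <;> rw [h, h'] at hne ⊢ <;>
      simp at hne ⊢
    have hsq : weightedSignedKnapsack γ F * weightedSignedKnapsack γ F =
        weight γ F * weight γ F := by
      rw [weightedSignedKnapsack_eq]
      rcases neg_one_pow_eq_or ℤ (n - F.length) with h | h <;> rw [h] <;> simp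
    -- At weight zero the two roots coincide and give only one factor `X`; it is enough because `t`
    -- itself already acts as zero on this layer.
    by_cases h0 : weight γ F = 0
    · refine ⟨X - C (weightedSignedKnapsack γ F), Finset.dvd_prod_of_mem (fun κ => X - C κ) (hmem F rfl), ?_⟩
      have h1 := ht.mul_sub_mem hγ hy
      rw [h0, zero_smul, sub_zero] at h1
      rwa [weightedSignedKnapsack_eq, h0, mul_zero, C_0, sub_zero, aeval_X]
    · refine ⟨(X - C (weightedSignedKnapsack γ F)) * (X - C (weightedSignedKnapsack γ G)), ?_, ?_⟩
      · have hneκ : weightedSignedKnapsack γ F ≠ weightedSignedKnapsack γ G := by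
          intro h
          rw [hκ, self_eq_neg] at h
          have := habs _ (hmem F rfl)
          rw [h, abs_zero] at this
          exact h0 this.symm
        rw [← Finset.prod_pair hneκ (f := fun κ => X - C κ)]
        refine Finset.prod_dvd_prod_of_subset _ _ _ ?_
        rw [Finset.insert_subset_iff, Finset.singleton_subset_iff]
        exact ⟨hmem F rfl, hmem G hG⟩
      · have h1 := ht.mul_mul_sub_mem hγ hy
        have hp : (X - C (weightedSignedKnapsack γ F)) * (X - C (weightedSignedKnapsack γ G)) =
            X * X - C (weight γ F * weight γ F) := by
          rw [hκ, ← hsq, C_neg, C_mul]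
          ring
        rwa [hp, map_sub, map_mul, aeval_X, aeval_C, mul_sub, ← mul_assoc, ← Algebra.commutes,
          ← Algebra.smul_def]

open Polynomial in
-- The induction adds a new smallest weight `a`. The factor for `a` moves a face operator of weight
-- `a` into the span of larger weights; these lie in `s` by upward closure, so the factors for `s`
-- kill the result.
theorem op_mul_aeval_prod_eq_zero (ht : IsLongestWordProduct γ t) (hγ : ∀ α, 0 ≤ γ α)
    (s : Finset k) : (∀ μ ∈ s, ∀ F : Face n, μ ≤ weight γ F → weight γ F ∈ s) →
    ∀ F : Face n, weight γ F ∈ s → F.op k * aeval t (∏ μ ∈ s,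
      ∏ κ ∈ ((Finset.univ : Finset (Face n)).image (weightedSignedKnapsack γ)).filter
        (fun κ => |κ| = μ), (X - C κ)) = 0 := by
  induction s using Finset.induction_on_min with
  | empty => exact fun _ _ h => absurd h (Finset.notMem_empty _)
  | insert a s has ih =>
    intro hup F hF
    have has' : a ∉ s := fun h => lt_irrefl a (has a h)
    have hup' : ∀ μ ∈ s, ∀ F : Face n, μ ≤ weight γ F → weight γ F ∈ s := fun μ hμ F hF =>
      (Finset.mem_insert.mp (hup μ (Finset.mem_insert_of_mem hμ) F hF)).resolve_left
        ((has μ hμ).trans_le hF).ne'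
    rw [Finset.prod_insert has']
    rcases Finset.mem_insert.mp hF with h | h
    · rw [map_mul, ← mul_assoc, ← Submodule.mem_bot k]
      refine map_mem_of_mem_opSpan (γ := γ) (S := Set.Ioi (weight γ F))
        (f := LinearMap.mulRight k _) (fun H hH => ?_)
        (h ▸ ht.op_mul_aeval_layer_mem hγ F)
      rw [Submodule.mem_bot]
      refine ih hup' H ((Finset.mem_insert.mp (hup a (Finset.mem_insert_self a s) H
        (h ▸ (Set.mem_Ioi.mp hH).le))).resolve_left ?_)
      rw [← h]
      exact (Set.mem_Ioi.mp hH).ne'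
    · rw [mul_comm, map_mul, ← mul_assoc, ih hup' F h, zero_mul]

theorem aeval_knapsackPolynomial (ht : IsLongestWordProduct γ t) (hγ : ∀ α, 0 ≤ γ α) :
    Polynomial.aeval t (knapsackPolynomial γ) = 0 := by
  -- With a constant key, stable sorting changes nothing, so this face acts as the identity.
  let F₀ : Face n := ofFun fun _ => 0
  have hF₀ : F₀.op k = 1 := by
    refine end_ext k fun w => ?_
    rw [op_of, act, Tuple.sort_eq_refl_iff_monotone.mpr]
    · rfl
    · intro x y _
      rw [key_perm]
      exact (ofFun_key_le_iff _).mpr le_rfl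
  have h := ht.op_mul_aeval_prod_eq_zero hγ (Finset.univ.image (weight γ))
    (fun _ _ F _ => Finset.mem_image_of_mem _ (Finset.mem_univ F)) F₀
    (Finset.mem_image_of_mem _ (Finset.mem_univ F₀))
  -- Every signed knapsack number has a weight as absolute value, so the layer factors reassemble to
  -- the full product, each root occurring once.
  rw [hF₀, one_mul, Finset.prod_fiberwise_of_maps_to] at h
  · exact h
  · intro κ hκ
    obtain ⟨F, -, rfl⟩ := Finset.mem_image.mp hκ
    refine Finset.mem_image.mpr ⟨F, Finset.mem_univ _, ?_⟩
    rw [weightedSignedKnapsack_eq]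
    rcases neg_one_pow_eq_or ℤ (n - F.length) with h | h <;> rw [h] <;>
      simp [abs_of_nonneg (weight_nonneg hγ F)]

end IsLongestWordProduct

end Annihilation

end Face

/-! ### Return from operators to the group algebra -/

theorem LinearMap.aeval_mulRight_apply_one {R A : Type*} [CommRing R] [Ring A] [Algebra R A]
    (x : A) (p : Polynomial R) :
    Polynomial.aeval (LinearMap.mulRight R x : Module.End R A) p 1 = Polynomial.aeval x p := by
  simp only [Polynomial.aeval_eq_sum_range, LinearMap.sum_apply, LinearMap.smul_apply,
    LinearMap.pow_mulRight, LinearMap.mulRight_apply, one_mul]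

theorem mainTheorem6 (n : ℕ) {k : Type*} [CommRing k] [LinearOrder k] [IsOrderedRing k]
    (γ : Composition n → k) (hγ : ∀ α, 0 ≤ γ α) :
    Polynomial.aeval (MonoidAlgebra.of k (Equiv.Perm (Fin n)) (longestWord n) * weightedB γ)
        (knapsackPolynomial γ) = 0 ∧
      Polynomial.aeval (weightedB γ * MonoidAlgebra.of k (Equiv.Perm (Fin n)) (longestWord n))
        (knapsackPolynomial γ) = 0 := by
  constructor
  -- Right multiplication reverses products: `w₀ B_γ` corresponds to the composition in which `w₀`
  -- is applied first, that is, stands on the right.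
  · rw [← LinearMap.aeval_mulRight_apply_one, Face.IsLongestWordProduct.aeval_knapsackPolynomial
      (Or.inr (LinearMap.mulRight_mul ..)) hγ, LinearMap.zero_apply]
  · rw [← LinearMap.aeval_mulRight_apply_one, Face.IsLongestWordProduct.aeval_knapsackPolynomial
      (Or.inl (LinearMap.mulRight_mul ..)) hγ, LinearMap.zero_apply]
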